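/- Let $\mathcal H$ and $\mathcal G$ be real Hilbert spaces, let $A\colon\mathcal H\to 2^{\mathcal H}$ and $B\colon\mathcal G\to 2^{\mathcal G}$ be maximally monotone operators, and let $L\colon\mathcal H\to\mathcal G$ be a non-zero bounded linear operator with adjoint $L^*$. Assume that the set of Kuhn–Tucker points $$\boldsymbol Z=\{(\hat x,\hat u)\in\mathcal H\times\mathcal G \;:\; 0\in A\hat x+L^*\hat u,\ 0\in B^{-1}\hat u-L\hat x\}$$ is non-empty. Let $\Upsilon\colon\mathcal H\to\mathcal H$ and $\Sigma\colon\mathcal G\to\mathcal G$ be bounded self-adjoint linear operators that are strongly monotone (that is, $\langle x,\Upsilon x\rangle\ge\tau\|x\|^2$ for all $x\in\mathcal H$ and $\langle u,\Sigma u\rangle\ge\sigma\|u\|^2$ for all $u\in\mathcal G$, for some $\tau,\sigma>0$) and such that $\Upsilon^{-1}-L^*\Sigma L$ is monotone. Write $J_M=(\mathrm{Id}+M)^{-1}$ for the resolvent of a set-valued operator $M$. Let $(x_0,u_0)\in\mathcal H\times\mathcal G$ and consider the Split-Douglas–Rachford recurrence $$(\forall n\in\mathbb N)\qquad \begin{aligned}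 v_n&=\Sigma(\mathrm{Id}-J_{\Sigma^{-1}B})(Lx_n+\Sigma^{-1}u_n),\\ z_n&=x_n-\Upsilon L^*v_n,\\ x_{n+1}&=J_{\Upsilon A}z_n,\\ u_{n+1}&=\Sigma L(x_{n+1}-x_n)+v_n. \end{aligned}$$ Then this recurrence defines a unique sequence $((x_n,u_n))_{n\in\mathbb N}$ starting at $(x_0,u_0)$, and the following hold: 1. $\sum_{n}\|x_{n+1}-x_n\|^2<+\infty$ and $\sum_{n}\|u_{n+1}-u_n\|^2<+\infty$. 2. There exists $(\hat x,\hat u)\in\boldsymbol Z$ such that $(x_n,u_n)\rightharpoonup(\hat x,\hat u)$ weakly in the Hilbert direct sum $\mathcal H\oplus\mathcal G$. -/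

import Mathlib

open Filter Topology
open scoped InnerProductSpace InnerProduct

namespace SplitDR

variable {E F : Type*} [NormedAddCommGroup E] [InnerProductSpace ℝ E]
  [NormedAddCommGroup F] [InnerProductSpace ℝ F]

/-- A set-valued operator `A : E → 2^E` is monotone if `⟪x - y, u - v⟫ ≥ 0` for all `(x, u)` and
`(y, v)` in its graph. -/
def MonotoneOp (A : E → Set E) : Prop :=
  ∀ x y : E, ∀ u ∈ A x, ∀ v ∈ A y, 0 ≤ ⟪x - y, u - v⟫_ℝ

/-- Maximally monotone: monotone, with a graph that is maximal for inclusion among the graphs of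
monotone operators (the order on `E → Set E` is pointwise inclusion, i.e. inclusion of graphs). -/
def MaximallyMonotone (A : E → Set E) : Prop :=
  Maximal MonotoneOp A

/-- `T` is strongly monotone: it is `β`-strongly monotone for some `β > 0`. -/
def StronglyMonotone (T : E → E) : Prop :=
  ∃ β : ℝ, 0 < β ∧ ∀ x y : E, β * ‖x - y‖ ^ 2 ≤ ⟪x - y, T x - T y⟫_ℝ

/-- The inverse of a set-valued operator. -/
def inverseOp (A : E → Set E) : E → Set E :=
  fun u => {x | u ∈ A x}

/-- The resolvent `J_M = (Id + M)⁻¹`, as a set-valued operator. -/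
def resolventOp (M : E → Set E) : E → Set E :=
  inverseOp fun x => (fun m => x + m) '' M x

/-- The composition `T M` of a set-valued operator `M` with a linear operator `T`. -/
def compOp (T : E →L[ℝ] E) (M : E → Set E) : E → Set E :=
  fun x => T '' M x

variable [CompleteSpace E] [CompleteSpace F]

/-- The set of Kuhn–Tucker points: the pairs `(x, u)` with `0 ∈ A x + L* u` and
`0 ∈ B⁻¹ u - L x`. -/
def kuhnTucker (A : E → Set E) (B : F → Set F) (L : E →L[ℝ] F) : Set (E × F) :=
  {p | (0 : E) ∈ (fun a => a + L.adjoint p.2) '' A p.1 ∧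
       (0 : F) ∈ (fun b => b - L p.1) '' inverseOp B p.2}

/-- `(x n, u n)` is generated from `(x₀, u₀)` by the Split-Douglas–Rachford recurrence
* `v n = Sig (Id - J_{Sig⁻¹ B}) (L (x n) + Sig⁻¹ (u n))`,
* `z n = x n - Ups L* (v n)`,
* `x (n+1) = J_{Ups A} (z n)`,
* `u (n+1) = Sig L (x (n+1) - x n) + v n`.

Resolvents are set-valued here, so that `=` becomes `∈` where they occur. The operators `Ups` and
`Sig` are used for strongly monotone ones, which are invertible, and then
`ContinuousLinearMap.inverse` is the true inverse. -/
def IsSDRSequence (A : E → Set E) (B : F → Set F) (L : E →L[ℝ] F) (Ups : E →L[ℝ] E)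
    (Sig : F →L[ℝ] F) (x₀ : E) (u₀ : F) (x : ℕ → E) (u : ℕ → F) : Prop :=
  x 0 = x₀ ∧ u 0 = u₀ ∧ ∃ (v : ℕ → F) (z : ℕ → E), ∀ n : ℕ,
    v n ∈ (fun p => Sig ((L (x n) + Sig.inverse (u n)) - p)) ''
      resolventOp (compOp Sig.inverse B) (L (x n) + Sig.inverse (u n)) ∧
    z n = x n - Ups (L.adjoint (v n)) ∧
    x (n + 1) ∈ resolventOp (compOp Ups A) (z n) ∧
    u (n + 1) = Sig (L (x (n + 1) - x n)) + v n

/-- Weak convergence `w n ⇀ a` in the Hilbert direct sum `E ⊕ F`. -/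
def WeaklyConverges (w : ℕ → E × F) (a : E × F) : Prop :=
  Tendsto (fun n => toWeakSpace ℝ (WithLp 2 (E × F)) (WithLp.toLp 2 (w n))) atTop
    (𝓝 (toWeakSpace ℝ (WithLp 2 (E × F)) (WithLp.toLp 2 a)))

end SplitDR

/-!
Write `P = Ups⁻¹`, `Q = Sig⁻¹`, `M = P - L* Sig L`, and `Δ n = x (n+1) - x n`,
`δ n = v n - u n`. Unfolding the resolvents, the recurrence says that
`-P (Δ n) - L* (v n)` is a value of `A` at `x (n+1)` and that `v n` is a value of `B` at
`L (x n) - Q (δ n)`.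

Well-posedness is Minty's theorem in the metric of a strongly monotone operator
(`MaximallyMonotone.exists_inverse_sub_mem`). It is obtained by minimising the sum of the
Fitzpatrick function of `A` and the strongly convex form `(⟪x, P x⟫ + ⟪u, P⁻¹ u⟫) / 2`: minimising
sequences are Cauchy, and the optimality condition produces the required point of the graph.

Monotonicity of `A` and `B` against a Kuhn–Tucker point `(a, b)` gives the Fejér inequality
`fejer_step`: the quantity `⟪x n - a, P (x n - a)⟫ + ⟪u n - b, Q (u n - b)⟫` decreases by at least
`⟪Δ n, M (Δ n)⟫ + ⟪δ n, Q (δ n)⟫`. As `M` may be degenerate, this bounds `δ n` but not `Δ n`.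
Monotonicity of `A` between consecutive iterates (`inner_step_le`) gives
`⟪Δ (n+1), P (Δ (n+1))⟫ ≤ ⟪Δ (n+1), M (Δ n)⟫ - ⟪L (Δ (n+1)), δ (n+1)⟫`, where the right-hand side
is controlled by the summable quantities and half of the left-hand side. This yields the square
summability of `Δ`, and that of `u (n+1) - u n = Sig L (Δ n) + δ n` follows.

The iterates are bounded, so they converge weakly along every ultrafilter finer than `atTop`. Each
such limit is a Kuhn–Tucker point (`weak_limit_mem_kuhnTucker`), and by Opial's argument in the
metric `(P, Q)` all these limits coincide (`eq_of_weak_limits`), which is weak convergence.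
-/

namespace SplitDR

/-! ### Maximally monotone operators and strongly monotone linear operators -/

section Operators

variable {E : Type*} [NormedAddCommGroup E] [InnerProductSpace ℝ E]

/-- A point monotonically related to the graph of a maximally monotone operator belongs to it. -/
theorem MaximallyMonotone.mem_of_forall {A : E → Set E} (hA : MaximallyMonotone A) {x u : E}
    (h : ∀ y, ∀ v ∈ A y, 0 ≤ ⟪x - y, u - v⟫_ℝ) : u ∈ A x := by
  have hle : A ≤ fun y => {v | v ∈ A y ∨ (y = x ∧ v = u)} := fun y v hv => Or.inl hv
  refine hA.2 (y := fun y => {v | v ∈ A y ∨ (y = x ∧ v = u)}) ?_ hle x (Or.inr ⟨rfl, rfl⟩)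
  rintro y z v (hv | ⟨rfl, rfl⟩) w (hw | ⟨rfl, rfl⟩)
  · exact hA.1 y z v hv w hw
  · have := h y v hv
    rwa [← neg_sub, ← neg_sub v, inner_neg_neg] at this
  · exact h z w hw
  · simp

theorem StronglyMonotone.exists_coercive {T : E →L[ℝ] E} (hT : StronglyMonotone T) :
    ∃ c : ℝ, 0 < c ∧ ∀ x, c * ‖x‖ ^ 2 ≤ ⟪x, T x⟫_ℝ := by
  obtain ⟨c, hc, h⟩ := hT
  exact ⟨c, hc, fun x => by simpa using h x 0⟩

variable [CompleteSpace E]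

theorem inner_map_comm {T : E →L[ℝ] E} (hT : IsSelfAdjoint T) (x y : E) :
    ⟪x, T y⟫_ℝ = ⟪y, T x⟫_ℝ := by
  rw [real_inner_comm, ← ContinuousLinearMap.adjoint_inner_right, hT.adjoint_eq]

/-- A coercive bounded operator is invertible, by the Lax–Milgram theorem. -/
theorem StronglyMonotone.isInvertible {T : E →L[ℝ] E} (hT : StronglyMonotone T) :
    T.IsInvertible := by
  obtain ⟨c, hc, h⟩ := hT.exists_coercive
  have hco : IsCoercive ((innerSL ℝ).comp T) := by
    refine ⟨c, hc, fun u => ?_⟩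
    have := h u
    rw [real_inner_comm] at this
    simpa [pow_two, mul_assoc] using this
  refine ⟨hco.continuousLinearEquivOfBilin, ?_⟩
  ext x
  refine (hco.unique_continuousLinearEquivOfBilin fun w => ?_).symm
  simp

theorem isSelfAdjoint_inverse {T : E →L[ℝ] E} (hT : IsSelfAdjoint T) (hT' : StronglyMonotone T) :
    IsSelfAdjoint T.inverse := by
  refine (ContinuousLinearMap.isSelfAdjoint_iff_isSymmetric).2 fun x y => ?_
  have h := inner_map_comm hT (T.inverse x) (T.inverse y)
  rw [hT'.isInvertible.self_apply_inverse, hT'.isInvertible.self_apply_inverse] at h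
  simpa [real_inner_comm] using h

theorem StronglyMonotone.inverse {T : E →L[ℝ] E} (hT' : StronglyMonotone T) :
    StronglyMonotone T.inverse := by
  obtain ⟨c, hc, h⟩ := hT'.exists_coercive
  refine ⟨c / (‖T‖ + 1) ^ 2, by positivity, fun x' y' => ?_⟩
  rw [← map_sub]
  generalize x' - y' = x
  set y := T.inverse x with hy
  have hx : T y = x := hT'.isInvertible.self_apply_inverse x
  have h1 : ‖x‖ ≤ (‖T‖ + 1) * ‖y‖ := by
    rw [← hx]
    exact (T.le_opNorm y).trans (by gcongr; linarith)
  have h2 := h y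
  rw [hx, real_inner_comm] at h2
  calc c / (‖T‖ + 1) ^ 2 * ‖x‖ ^ 2 ≤ c / (‖T‖ + 1) ^ 2 * ((‖T‖ + 1) * ‖y‖) ^ 2 := by gcongr
    _ = c * ‖y‖ ^ 2 := by field_simp
    _ ≤ _ := h2

end Operators

/-! ### Minty's theorem in the metric of a strongly monotone operator -/

section Minty

variable {E : Type*} [NormedAddCommGroup E] [InnerProductSpace ℝ E]

/-- The epigraph of the Fitzpatrick function
`(x, u) ↦ sup {⟪y, u⟫ + ⟪x, v⟫ - ⟪y, v⟫ | v ∈ A y}` of `A`. -/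
def fitzpatrickEpigraph (A : E → Set E) : Set (E × E × ℝ) :=
  {p | ∀ y, ∀ v ∈ A y, ⟪y, p.2.1⟫_ℝ + ⟪p.1, v⟫_ℝ - ⟪y, v⟫_ℝ ≤ p.2.2}

theorem convex_fitzpatrickEpigraph (A : E → Set E) : Convex ℝ (fitzpatrickEpigraph A) := by
  rintro ⟨x, u, t⟩ hp ⟨x', u', t'⟩ hq a b ha hb hab y v hv
  have h1 := mul_le_mul_of_nonneg_left (hp y v hv) ha
  have h2 := mul_le_mul_of_nonneg_left (hq y v hv) hb
  simp only [Prod.smul_mk, Prod.mk_add_mk, smul_eq_mul, inner_add_left, inner_add_right,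
    real_inner_smul_left, real_inner_smul_right] at h1 h2 ⊢
  obtain rfl : b = 1 - a := by linarith
  linarith

theorem isClosed_fitzpatrickEpigraph (A : E → Set E) : IsClosed (fitzpatrickEpigraph A) := by
  simp only [fitzpatrickEpigraph, Set.ofPred_forall]
  refine isClosed_iInter fun y => isClosed_iInter fun v => isClosed_iInter fun _ => ?_
  exact isClosed_le (by fun_prop) (by fun_prop)

theorem mem_fitzpatrickEpigraph_of_mem {A : E → Set E} (hA : MonotoneOp A) {y v : E}
    (hv : v ∈ A y) : (y, v, ⟪y, v⟫_ℝ) ∈ fitzpatrickEpigraph A := by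
  intro z w hw
  have := hA y z v hv w hw
  simp only [inner_sub_left, inner_sub_right] at this
  simp only
  linarith

/-- The Fitzpatrick function of a maximally monotone operator dominates the duality pairing. -/
theorem inner_le_of_mem_fitzpatrickEpigraph {A : E → Set E} (hA : MaximallyMonotone A) {x u : E}
    {t : ℝ} (h : (x, u, t) ∈ fitzpatrickEpigraph A) : ⟪x, u⟫_ℝ ≤ t := by
  by_cases hu : u ∈ A x
  · have := h x u hu
    simp only at this
    linarith
  · have hn : ¬ ∀ y, ∀ v ∈ A y, 0 ≤ ⟪x - y, u - v⟫_ℝ := fun h' => hu (hA.mem_of_forall h')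
    push Not at hn
    obtain ⟨y, v, hv, hlt⟩ := hn
    have := h y v hv
    simp only [inner_sub_left, inner_sub_right] at this hlt
    linarith

/-- The objective `t + (⟪x, P x⟫ + ⟪u, Q u⟫) / 2` on triples `(x, u, t)`. Minimised over the
epigraph of the Fitzpatrick function, it gives the proof of Minty's theorem; `Q` is to be `P⁻¹`. -/
noncomputable def mintyValue (P Q : E →L[ℝ] E) (p : E × E × ℝ) : ℝ :=
  p.2.2 + (⟪p.1, P p.1⟫_ℝ + ⟪p.2.1, Q p.2.1⟫_ℝ) / 2

theorem mintyValue_segment {P Q : E →L[ℝ] E} (hP : ∀ x y, ⟪x, P y⟫_ℝ = ⟪y, P x⟫_ℝ)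
    (hQ : ∀ x y, ⟪x, Q y⟫_ℝ = ⟪y, Q x⟫_ℝ) (p q : E × E × ℝ) (s : ℝ) :
    mintyValue P Q ((1 - s) • p + s • q) =
      (1 - s) * mintyValue P Q p + s * mintyValue P Q q -
        s * (1 - s) / 2 * (⟪p.1 - q.1, P (p.1 - q.1)⟫_ℝ +
          ⟪p.2.1 - q.2.1, Q (p.2.1 - q.2.1)⟫_ℝ) := by
  obtain ⟨x, u, t⟩ := p
  obtain ⟨x', u', t'⟩ := q
  simp only [mintyValue, Prod.smul_mk, Prod.mk_add_mk, smul_eq_mul, inner_add_left,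
    inner_add_right, inner_sub_left, inner_sub_right, map_add, map_sub, map_smul,
    real_inner_smul_left, real_inner_smul_right, hP x' x, hQ u' u]
  ring

theorem inner_add_metric {P Q : E →L[ℝ] E} (hP : ∀ x y, ⟪x, P y⟫_ℝ = ⟪y, P x⟫_ℝ)
    (hPQ : ∀ x, P (Q x) = x) (x u : E) :
    ⟪x + Q u, P (x + Q u)⟫_ℝ = ⟪x, P x⟫_ℝ + ⟪u, Q u⟫_ℝ + 2 * ⟪x, u⟫_ℝ := by
  simp only [map_add, hPQ, inner_add_left, inner_add_right, hP (Q u) x, real_inner_comm u (Q u)]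
  ring

theorem MaximallyMonotone.translate {A : E → Set E} (hA : MaximallyMonotone A) (z : E) :
    MaximallyMonotone fun x => A (x + z) := by
  refine ⟨fun x y u hu v hv => by simpa using hA.1 _ _ u hu v hv, fun B hB hAB x u hu => ?_⟩
  refine hA.mem_of_forall fun y v hv => ?_
  have := hB x (y - z) u hu v (hAB (y - z) (by simpa using hv))
  rwa [sub_sub_eq_add_sub] at this

theorem mem_resolventOp_compOp_iff {A : E → Set E} {T : E →L[ℝ] E} (hT : T.IsInvertible)
    {z x : E} : x ∈ resolventOp (compOp T A) z ↔ T.inverse (z - x) ∈ A x := by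
  constructor
  · rintro ⟨_, ⟨a, ha, rfl⟩, h⟩
    simp only at h
    rwa [← h, add_sub_cancel_left, hT.inverse_apply_self]
  · intro h
    exact ⟨_, ⟨_, h, rfl⟩, by simp [hT.self_apply_inverse]⟩

variable [CompleteSpace E]

/-- Existence of a minimiser: the objective is bounded below and strongly convex in `(x, u)`, so
minimising sequences are Cauchy. -/
theorem exists_minimizer_mintyValue {A : E → Set E} (hA : MaximallyMonotone A)
    {P Q : E →L[ℝ] E} (hP : ∀ x y, ⟪x, P y⟫_ℝ = ⟪y, P x⟫_ℝ)
    (hQ : ∀ x y, ⟪x, Q y⟫_ℝ = ⟪y, Q x⟫_ℝ) (hPQ : ∀ x, P (Q x) = x)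
    {c : ℝ} (hc : 0 < c) (hPc : ∀ x, c * ‖x‖ ^ 2 ≤ ⟪x, P x⟫_ℝ)
    {d : ℝ} (hd : 0 < d) (hQd : ∀ x, d * ‖x‖ ^ 2 ≤ ⟪x, Q x⟫_ℝ) :
    ∃ p ∈ fitzpatrickEpigraph A, ∀ q ∈ fitzpatrickEpigraph A,
      mintyValue P Q p ≤ mintyValue P Q q := by
  have hne : (fitzpatrickEpigraph A).Nonempty := by
    by_cases h : ∃ y v, v ∈ A y
    · obtain ⟨y, v, hv⟩ := h
      exact ⟨_, mem_fitzpatrickEpigraph_of_mem hA.1 hv⟩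
    · push Not at h
      exact ⟨0, fun y v hv => (h y v hv).elim⟩
  have hbdd : BddBelow (mintyValue P Q '' fitzpatrickEpigraph A) := by
    refine ⟨0, ?_⟩
    rintro _ ⟨⟨x, u, t⟩, hp, rfl⟩
    have h1 := inner_le_of_mem_fitzpatrickEpigraph hA hp
    have h2 := inner_add_metric hP hPQ x u
    have h3 := hPc (x + Q u)
    have h4 : 0 ≤ c * ‖x + Q u‖ ^ 2 := by positivity
    simp only [mintyValue]
    linarith
  set m := sInf (mintyValue P Q '' fitzpatrickEpigraph A) with hm
  have hmle : ∀ q ∈ fitzpatrickEpigraph A, m ≤ mintyValue P Q q := fun q hq =>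
    csInf_le hbdd ⟨q, hq, rfl⟩
  have hseq : ∀ n : ℕ, ∃ p ∈ fitzpatrickEpigraph A, mintyValue P Q p < m + 1 / ((n : ℝ) + 1) := by
    intro n
    obtain ⟨_, ⟨p, hp, rfl⟩, hlt⟩ := exists_lt_of_csInf_lt (hne.image _)
      (lt_add_of_pos_right m (Nat.one_div_pos_of_nat (α := ℝ) (n := n)))
    exact ⟨p, hp, hlt⟩
  choose p hp hlt using hseq
  have key : ∀ n k N : ℕ, N ≤ n → N ≤ k →
      c * ‖(p n).1 - (p k).1‖ ^ 2 ≤ 8 * (1 / ((N : ℝ) + 1)) ∧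
      d * ‖(p n).2.1 - (p k).2.1‖ ^ 2 ≤ 8 * (1 / ((N : ℝ) + 1)) := by
    intro n k N hn hk
    have hmid := hmle _ (convex_fitzpatrickEpigraph A (hp n) (hp k)
      (show (0 : ℝ) ≤ 1 - 1 / 2 by norm_num) (show (0 : ℝ) ≤ 1 / 2 by norm_num) (by norm_num))
    rw [mintyValue_segment hP hQ] at hmid
    have h1 := (hlt n).trans_le (add_le_add_right (Nat.one_div_le_one_div (α := ℝ) hn) m)
    have h2 := (hlt k).trans_le (add_le_add_right (Nat.one_div_le_one_div (α := ℝ) hk) m)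
    have h3 := hPc ((p n).1 - (p k).1)
    have h4 := hQd ((p n).2.1 - (p k).2.1)
    have h5 : 0 ≤ c * ‖(p n).1 - (p k).1‖ ^ 2 := by positivity
    have h6 : 0 ≤ d * ‖(p n).2.1 - (p k).2.1‖ ^ 2 := by positivity
    constructor <;> linarith
  have cauchy : ∀ (f : ℕ → E) (a : ℝ), 0 < a →
      (∀ n k N : ℕ, N ≤ n → N ≤ k → a * ‖f n - f k‖ ^ 2 ≤ 8 * (1 / ((N : ℝ) + 1))) →
      CauchySeq f := by
    intro f a ha h
    refine cauchySeq_of_le_tendsto_0 (fun N : ℕ => √(8 / a * (1 / ((N : ℝ) + 1)))) ?_ ?_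
    · intro n k N hn hk
      rw [dist_eq_norm]
      refine Real.le_sqrt_of_sq_le ?_
      have := h n k N hn hk
      rw [div_mul_eq_mul_div, le_div_iff₀ ha]
      linarith
    · have := ((tendsto_one_div_add_atTop_nhds_zero_nat (𝕜 := ℝ)).const_mul (8 / a)).sqrt
      simpa using this
  obtain ⟨x, hx⟩ := cauchySeq_tendsto_of_complete
    (cauchy (fun n => (p n).1) c hc fun n k N hn hk => (key n k N hn hk).1)
  obtain ⟨u, hu⟩ := cauchySeq_tendsto_of_complete
    (cauchy (fun n => (p n).2.1) d hd fun n k N hn hk => (key n k N hn hk).2)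
  have hval : Tendsto (fun n => mintyValue P Q (p n)) atTop (𝓝 m) := by
    refine tendsto_of_tendsto_of_tendsto_of_le_of_le tendsto_const_nhds
      (h := fun n : ℕ => m + 1 / ((n : ℝ) + 1)) ?_ (fun n => hmle _ (hp n))
      (fun n => (hlt n).le)
    simpa using (tendsto_one_div_add_atTop_nhds_zero_nat (𝕜 := ℝ)).const_add m
  have ht : Tendsto (fun n => (p n).2.2) atTop
      (𝓝 (m - (⟪x, P x⟫_ℝ + ⟪u, Q u⟫_ℝ) / 2)) := by
    have h1 : Tendsto (fun n => ⟪(p n).1, P (p n).1⟫_ℝ) atTop (𝓝 ⟪x, P x⟫_ℝ) :=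
      hx.inner ((P.continuous.tendsto x).comp hx)
    have h2 : Tendsto (fun n => ⟪(p n).2.1, Q (p n).2.1⟫_ℝ) atTop (𝓝 ⟪u, Q u⟫_ℝ) :=
      hu.inner ((Q.continuous.tendsto u).comp hu)
    refine (hval.sub ((h1.add h2).div_const 2)).congr fun n => ?_
    simp only [mintyValue]
    ring
  have hlim := hx.prodMk_nhds (hu.prodMk_nhds ht)
  refine ⟨_, (isClosed_fitzpatrickEpigraph A).mem_of_tendsto hlim (.of_forall hp), ?_⟩
  intro q hq
  refine le_trans (le_of_eq ?_) (hmle q hq)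
  simp [mintyValue]

/-- If `(x, u)` minimises the Fitzpatrick function plus `(⟪x, P x⟫ + ⟪u, Q u⟫) / 2`, where
`Q = P⁻¹`, then optimality makes `(-Q u, -P x)` monotonically related to the graph of `A`, hence a
point of it, and comparing with this very point forces `x = -Q u`. -/
theorem exists_neg_mem {A : E → Set E} (hA : MaximallyMonotone A)
    {P Q : E →L[ℝ] E} (hP : ∀ x y, ⟪x, P y⟫_ℝ = ⟪y, P x⟫_ℝ)
    (hQ : ∀ x y, ⟪x, Q y⟫_ℝ = ⟪y, Q x⟫_ℝ) (hPQ : ∀ x, P (Q x) = x)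
    {c : ℝ} (hc : 0 < c) (hPc : ∀ x, c * ‖x‖ ^ 2 ≤ ⟪x, P x⟫_ℝ)
    {d : ℝ} (hd : 0 < d) (hQd : ∀ x, d * ‖x‖ ^ 2 ≤ ⟪x, Q x⟫_ℝ) :
    ∃ x, -P x ∈ A x := by
  obtain ⟨⟨x, u, t⟩, hp, hmin⟩ := exists_minimizer_mintyValue hA hP hQ hPQ hc hPc hd hQd
  have hxu := inner_le_of_mem_fitzpatrickEpigraph hA hp
  have opt : ∀ y, ∀ v ∈ A y,
      ⟪x + Q u, P (x + Q u)⟫_ℝ ≤ ⟪-Q u - y, -P x - v⟫_ℝ := by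
    intro y v hv
    have hq := mem_fitzpatrickEpigraph_of_mem hA.1 hv
    set D := mintyValue P Q (y, v, ⟪y, v⟫_ℝ) - mintyValue P Q (x, u, t) with hD
    set N := ⟪x - y, P (x - y)⟫_ℝ + ⟪u - v, Q (u - v)⟫_ℝ with hN
    have hs : ∀ s : ℝ, 0 < s → s ≤ 1 → 0 ≤ D - (1 - s) / 2 * N := by
      intro s hs hs1
      have h := hmin _ (convex_fitzpatrickEpigraph A hp hq (sub_nonneg.2 hs1) hs.le (by ring))
      rw [mintyValue_segment hP hQ] at h
      refine nonneg_of_mul_nonneg_right (a := s) ?_ hs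
      simp only at h
      rw [← hN] at h
      rw [hD]
      linarith
    have hlim : Tendsto (fun s : ℝ => D - (1 - s) / 2 * N) (𝓝[>] 0) (𝓝 (D - (1 - 0) / 2 * N)) :=
      (Continuous.tendsto (by fun_prop) 0).mono_left nhdsWithin_le_nhds
    have h0 : 0 ≤ D - (1 - 0) / 2 * N := by
      refine ge_of_tendsto hlim ?_
      filter_upwards [Ioc_mem_nhdsGT (show (0 : ℝ) < 1 by norm_num)] with s hs'
      exact hs s hs'.1 hs'.2
    have hQP : ⟪Q u, P x⟫_ℝ = ⟪x, u⟫_ℝ := by rw [hP, hPQ]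
    rw [inner_add_metric hP hPQ]
    simp only [hD, hN, mintyValue, inner_sub_left, inner_sub_right, inner_neg_left,
      inner_neg_right, map_sub, hP y x, hQ v u, hQP] at h0 ⊢
    have h1 := real_inner_comm v (Q u)
    have h2 := hQ v u
    linarith
  have hnn : 0 ≤ ⟪x + Q u, P (x + Q u)⟫_ℝ := le_trans (by positivity) (hPc _)
  have hmem : -P x ∈ A (-Q u) := hA.mem_of_forall fun y v hv => hnn.trans (opt y v hv)
  have h0 := (hPc _).trans (opt _ _ hmem)
  simp only [sub_self, inner_zero_left] at h0
  have hz : x + Q u = 0 := by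
    by_contra hne
    have : 0 < c * ‖x + Q u‖ ^ 2 := by have := norm_pos_iff.2 hne; positivity
    linarith
  refine ⟨x, ?_⟩
  rwa [← eq_neg_of_add_eq_zero_left hz] at hmem

/-- Minty's theorem for `T A`, where `T` is self-adjoint and strongly monotone: the resolvent
of `T A` is everywhere defined. -/
theorem MaximallyMonotone.exists_inverse_sub_mem {A : E → Set E} (hA : MaximallyMonotone A)
    {T : E →L[ℝ] E} (hT : IsSelfAdjoint T) (hT' : StronglyMonotone T) (z : E) :
    ∃ x, T.inverse (z - x) ∈ A x := by
  obtain ⟨c, hc, hPc⟩ := hT'.inverse.exists_coercive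
  obtain ⟨d, hd, hQd⟩ := hT'.exists_coercive
  obtain ⟨x, hx⟩ := exists_neg_mem (hA.translate z) (inner_map_comm (isSelfAdjoint_inverse hT hT'))
    (inner_map_comm hT) hT'.isInvertible.inverse_apply_self hc hPc hd hQd
  exact ⟨x + z, by simpa using hx⟩

/-- The resolvent of `T A` is at most single-valued. -/
theorem MonotoneOp.eq_of_inverse_sub_mem {A : E → Set E} (hA : MonotoneOp A) {T : E →L[ℝ] E}
    (hT' : StronglyMonotone T) {z x y : E} (hx : T.inverse (z - x) ∈ A x)
    (hy : T.inverse (z - y) ∈ A y) : x = y := by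
  obtain ⟨c, hc, h⟩ := hT'.inverse.exists_coercive
  have h1 := hA x y _ hx _ hy
  rw [← map_sub, sub_sub_sub_cancel_left, ← neg_sub x y, map_neg, inner_neg_right] at h1
  have h2 := h (x - y)
  by_contra hne
  have : 0 < c * ‖x - y‖ ^ 2 := by have := norm_pos_iff.2 (sub_ne_zero.2 hne); positivity
  linarith

theorem MaximallyMonotone.existsUnique_resolventOp {A : E → Set E} (hA : MaximallyMonotone A)
    {T : E →L[ℝ] E} (hT : IsSelfAdjoint T) (hT' : StronglyMonotone T) (z : E) :
    ∃! x, x ∈ resolventOp (compOp T A) z := by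
  simp only [mem_resolventOp_compOp_iff hT'.isInvertible]
  obtain ⟨x, hx⟩ := hA.exists_inverse_sub_mem hT hT' z
  exact ⟨x, hx, fun y hy => hA.1.eq_of_inverse_sub_mem hT' hy hx⟩

end Minty

/-! ### Weak limits along ultrafilters -/

section WeakLimits

variable {E : Type*} [NormedAddCommGroup E] [InnerProductSpace ℝ E]

/-- Weak compactness of bounded sets: a bounded sequence in a Hilbert space converges weakly along
every ultrafilter. The limits of `⟪x n, y⟫` are a bounded linear functional of `y`, represented by
the weak limit. -/
theorem exists_weak_limit [CompleteSpace E] {ι : Type*} (U : Ultrafilter ι) {x : ι → E} {C : ℝ}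
    (hx : ∀ n, ‖x n‖ ≤ C) :
    ∃ a, ∀ y, Tendsto (fun n => ⟪x n, y⟫_ℝ) U (𝓝 ⟪a, y⟫_ℝ) := by
  have hb : ∀ y n, ‖⟪x n, y⟫_ℝ‖ ≤ C * ‖y‖ := fun y n =>
    (norm_inner_le_norm _ _).trans (by gcongr; exact hx n)
  have hlim : ∀ y, ∃ l : ℝ, ‖l‖ ≤ C * ‖y‖ ∧ Tendsto (fun n => ⟪x n, y⟫_ℝ) U (𝓝 l) := by
    intro y
    obtain ⟨l, hl, hle⟩ := (isCompact_closedBall (0 : ℝ) (C * ‖y‖)).ultrafilter_le_nhds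
      (U.map fun n => ⟪x n, y⟫_ℝ) (by
        rw [le_principal_iff]
        refine Ultrafilter.mem_map.2 (univ_mem' fun n => ?_)
        simpa using hb y n)
    exact ⟨l, by simpa using hl, hle⟩
  choose f hfb hf using hlim
  let φ : E →L[ℝ] ℝ := LinearMap.mkContinuous
    { toFun := f
      map_add' := fun y z => tendsto_nhds_unique (hf (y + z))
        (((hf y).add (hf z)).congr fun n => (inner_add_right _ _ _).symm)
      map_smul' := fun c y => tendsto_nhds_unique (hf (c • y))
        (((hf y).const_mul c).congr fun n => (real_inner_smul_right _ _ _).symm) } C hfb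
  refine ⟨(InnerProductSpace.toDual ℝ E).symm φ, fun y => ?_⟩
  rw [InnerProductSpace.toDual_symm_apply]
  exact hf y

theorem tendsto_inner_zero_of_bounded {ι : Type*} {l : Filter ι} {x q : ι → E} {C : ℝ}
    (hx : ∀ n, ‖x n‖ ≤ C) (hq : Tendsto q l (𝓝 0)) :
    Tendsto (fun n => ⟪x n, q n⟫_ℝ) l (𝓝 0) := by
  refine squeeze_zero_norm (a := fun n => C * ‖q n‖)
    (fun n => (norm_inner_le_norm _ _).trans (by gcongr; exact hx n)) ?_
  simpa using hq.norm.const_mul C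

theorem weaklyConverges_of_tendsto_inner {F : Type*} [NormedAddCommGroup F]
    [InnerProductSpace ℝ F] [CompleteSpace E] [CompleteSpace F] {x : ℕ → E} {u : ℕ → F} {a : E}
    {b : F} (hx : ∀ y, Tendsto (fun n => ⟪x n, y⟫_ℝ) atTop (𝓝 ⟪a, y⟫_ℝ))
    (hu : ∀ y, Tendsto (fun n => ⟪u n, y⟫_ℝ) atTop (𝓝 ⟪b, y⟫_ℝ)) :
    WeaklyConverges (fun n => (x n, u n)) (a, b) := by
  refine (WeakBilin.tendsto_iff_forall_eval_tendsto _ ?_).2 fun f => ?_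
  · intro p q h
    refine (SeparatingDual.eq_iff_forall_dual_eq (R := ℝ)).2 fun g => ?_
    exact LinearMap.congr_fun h g
  · change Tendsto (fun n => f (WithLp.toLp 2 (x n, u n))) atTop (𝓝 (f (WithLp.toLp 2 (a, b))))
    obtain ⟨p, rfl⟩ := (InnerProductSpace.toDual ℝ (WithLp 2 (E × F))).surjective f
    have := (hx p.fst).add (hu p.snd)
    simpa [WithLp.prod_inner_apply, real_inner_comm] using this

end WeakLimits

/-! ### Quadratic forms and square-summable sequences -/

section Estimates

theorem tendsto_zero_of_summable_sq {E : Type*} [NormedAddCommGroup E] {w : ℕ → E}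
    (h : Summable fun n => ‖w n‖ ^ 2) :
    Tendsto w atTop (𝓝 0) := by
  rw [tendsto_zero_iff_norm_tendsto_zero]
  simpa using h.tendsto_atTop_zero.sqrt

variable {E : Type*} [NormedAddCommGroup E] [InnerProductSpace ℝ E]

theorem inner_le_half_add {M : E →L[ℝ] E} (hM : ∀ x y, ⟪x, M y⟫_ℝ = ⟪y, M x⟫_ℝ)
    (hM' : ∀ x, 0 ≤ ⟪x, M x⟫_ℝ) (x y : E) :
    ⟪x, M y⟫_ℝ ≤ (⟪x, M x⟫_ℝ + ⟪y, M y⟫_ℝ) / 2 := by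
  have := hM' (x - y)
  simp only [map_sub, inner_sub_left, inner_sub_right, hM y x] at this
  linarith

theorem summable_of_add_le {D g : ℕ → ℝ} (hD : ∀ n, 0 ≤ D n) (hg : ∀ n, 0 ≤ g n)
    (h : ∀ n, D (n + 1) + g n ≤ D n) : Summable g := by
  refine summable_of_sum_range_le (c := D 0) hg fun n => ?_
  have : ∀ n, ∑ i ∈ Finset.range n, g i ≤ D 0 - D n := by
    intro n
    induction n with
    | zero => simp
    | succ n ih =>
      rw [Finset.sum_range_succ]
      linarith [h n]
  linarith [this n, hD n]

theorem summable_sq_of_le {a b g : ℕ → ℝ} {c : ℝ} (ha : Summable fun n => a n ^ 2)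
    (hb : Summable fun n => b n ^ 2) (hg : ∀ n, 0 ≤ g n) (h : ∀ n, g n ≤ c * a n + b n) :
    Summable fun n => g n ^ 2 := by
  refine ((ha.mul_left (2 * c ^ 2)).add (hb.mul_left 2)).of_nonneg_of_le
    (fun n => sq_nonneg _) fun n => ?_
  have h1 : g n ^ 2 ≤ (c * a n + b n) ^ 2 := pow_le_pow_left₀ (hg n) (h n) 2
  linarith [sq_nonneg (c * a n - b n)]

theorem exists_norm_le_of_inner_le {P : E →L[ℝ] E} (hP : StronglyMonotone P) {x : ℕ → E} (a : E)
    {K : ℝ} (h : ∀ n, ⟪x n - a, P (x n - a)⟫_ℝ ≤ K) : ∃ C, ∀ n, ‖x n‖ ≤ C := by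
  obtain ⟨c, hc, hPc⟩ := hP.exists_coercive
  refine ⟨√(K / c) + ‖a‖, fun n => ?_⟩
  have h1 : ‖x n - a‖ ≤ √(K / c) := by
    refine Real.le_sqrt_of_sq_le ?_
    rw [le_div_iff₀ hc, mul_comm]
    exact (hPc _).trans (h n)
  have := norm_add_le (x n - a) a
  rw [sub_add_cancel] at this
  linarith

end Estimates

/-! ### The recurrence as a pair of monotone inclusions -/

section Recurrence

variable {E F : Type*} [NormedAddCommGroup E] [InnerProductSpace ℝ E]
  [NormedAddCommGroup F] [InnerProductSpace ℝ F] [CompleteSpace E] [CompleteSpace F]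
  {A : E → Set E} {B : F → Set F} {L : E →L[ℝ] F} {Ups : E →L[ℝ] E} {Sig : F →L[ℝ] F}

theorem mem_kuhnTucker_iff {p : E × F} :
    p ∈ kuhnTucker A B L ↔ -L.adjoint p.2 ∈ A p.1 ∧ p.2 ∈ B (L p.1) := by
  simp only [kuhnTucker, inverseOp, Set.mem_ofPred_eq, Set.mem_image, sub_eq_zero,
    exists_eq_right, add_eq_zero_iff_eq_neg]

/-- The recurrence with the resolvents unfolded: `v n` and `Ups⁻¹ (x n - x (n+1)) - L* (v n)` are
values of `B` and `A`, at explicit points. -/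
def IsInclusionSequence (A : E → Set E) (B : F → Set F) (L : E →L[ℝ] F) (Ups : E →L[ℝ] E)
    (Sig : F →L[ℝ] F) (x : ℕ → E) (u v : ℕ → F) : Prop :=
  ∀ n, v n ∈ B (L (x n) - Sig.inverse (v n - u n)) ∧
    -Ups.inverse (x (n + 1) - x n) - L.adjoint (v n) ∈ A (x (n + 1)) ∧
    u (n + 1) = Sig (L (x (n + 1) - x n)) + v n

theorem IsSDRSequence.exists_isInclusionSequence (hUps' : StronglyMonotone Ups)
    (hSig' : StronglyMonotone Sig) {x₀ : E} {u₀ : F} {x : ℕ → E} {u : ℕ → F}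
    (h : IsSDRSequence A B L Ups Sig x₀ u₀ x u) :
    ∃ v, IsInclusionSequence A B L Ups Sig x u v := by
  obtain ⟨-, -, v, z, h⟩ := h
  refine ⟨v, fun n => ?_⟩
  obtain ⟨⟨p, hp, hv⟩, hz, hx, hu⟩ := h n
  refine ⟨?_, ?_, hu⟩
  · rw [mem_resolventOp_compOp_iff hSig'.isInvertible.inverse,
      hSig'.isInvertible.inverse_inverse] at hp
    simp only at hv
    rw [hv] at hp
    convert hp using 2
    rw [← hv]
    simp only [map_sub, hSig'.isInvertible.inverse_apply_self]
    abel
  · rw [mem_resolventOp_compOp_iff hUps'.isInvertible, hz] at hx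
    convert hx using 1
    simp only [map_sub, hUps'.isInvertible.inverse_apply_self]
    abel

theorem existsUnique_isSDRSequence (hA : MaximallyMonotone A) (hB : MaximallyMonotone B)
    (hUps : IsSelfAdjoint Ups) (hUps' : StronglyMonotone Ups)
    (hSig : IsSelfAdjoint Sig) (hSig' : StronglyMonotone Sig) (x₀ : E) (u₀ : F) :
    ∃! w : (ℕ → E) × (ℕ → F), IsSDRSequence A B L Ups Sig x₀ u₀ w.1 w.2 := by
  choose JA hJA hJA' using hA.existsUnique_resolventOp hUps hUps'
  choose JB hJB hJB' using
    hB.existsUnique_resolventOp (isSelfAdjoint_inverse hSig hSig') hSig'.inverse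
  let V : E × F → F := fun p =>
    Sig ((L p.1 + Sig.inverse p.2) - JB (L p.1 + Sig.inverse p.2))
  let X : E × F → E := fun p => JA (p.1 - Ups (L.adjoint (V p)))
  let S : E × F → E × F := fun p => (X p, Sig (L (X p - p.1)) + V p)
  refine ⟨(fun n => (S^[n] (x₀, u₀)).1, fun n => (S^[n] (x₀, u₀)).2), ?_, ?_⟩
  · refine ⟨rfl, rfl, fun n => V (S^[n] (x₀, u₀)),
      fun n => (S^[n] (x₀, u₀)).1 - Ups (L.adjoint (V (S^[n] (x₀, u₀)))), fun n => ?_⟩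
    simp only [Function.iterate_succ_apply']
    exact ⟨⟨_, hJB _, rfl⟩, trivial, hJA _, rfl⟩
  · rintro ⟨x, u⟩ ⟨hx0, hu0, v, z, h⟩
    simp only at hx0 hu0 h
    have key : ∀ n, (x n, u n) = S^[n] (x₀, u₀) := by
      intro n
      induction n with
      | zero => exact Prod.ext hx0 hu0
      | succ n ih =>
        obtain ⟨⟨p, hp, hv⟩, hz, hx, hu⟩ := h n
        rw [Function.iterate_succ_apply', ← ih]
        have hV : v n = V (x n, u n) := by
          rw [← hv, hJB' _ p hp]
        have hX : x (n + 1) = X (x n, u n) := by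
          rw [hJA' _ _ hx, hz, hV]
        refine Prod.ext hX ?_
        simp only [S]
        rw [hu, hX, hV]
    refine Prod.ext (funext fun n => ?_) (funext fun n => ?_)
    · exact congrArg Prod.fst (key n)
    · exact congrArg Prod.snd (key n)

/-! ### Fejér monotonicity and square summability -/

/-- The square of the norm on `E × F` in which the iterates are Fejér monotone. -/
noncomputable def metricSq (P : E →L[ℝ] E) (Q : F →L[ℝ] F) (x : E) (u : F) : ℝ :=
  ⟪x, P x⟫_ℝ + ⟪u, Q u⟫_ℝ

/-- The Fejér inequality, by adding the monotonicity of `A` and of `B` against a Kuhn–Tucker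
point: the terms in `L` recombine through `Sig⁻¹ (u (n+1) - v n) = L (x (n+1) - x n)`. -/
theorem fejer_step (hA : MonotoneOp A) (hB : MonotoneOp B) (hUps : IsSelfAdjoint Ups)
    (hUps' : StronglyMonotone Ups) (hSig : IsSelfAdjoint Sig) (hSig' : StronglyMonotone Sig)
    {x : ℕ → E} {u v : ℕ → F} (h : IsInclusionSequence A B L Ups Sig x u v) {p : E × F}
    (hp : p ∈ kuhnTucker A B L) (n : ℕ) :
    metricSq Ups.inverse Sig.inverse (x (n + 1) - p.1) (u (n + 1) - p.2) +
      (⟪x (n + 1) - x n, (Ups.inverse - L.adjoint ∘L Sig ∘L L) (x (n + 1) - x n)⟫_ℝ +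
        ⟪v n - u n, Sig.inverse (v n - u n)⟫_ℝ) ≤
    metricSq Ups.inverse Sig.inverse (x n - p.1) (u n - p.2) := by
  obtain ⟨a, b⟩ := p
  obtain ⟨hpA, hpB⟩ := mem_kuhnTucker_iff.1 hp
  obtain ⟨hv, hx, hu⟩ := h n
  have h1 := hA _ _ _ hx _ hpA
  have h2 := hB _ _ _ hv _ hpB
  have hP := inner_map_comm (isSelfAdjoint_inverse hUps hUps')
  have hQ := inner_map_comm (isSelfAdjoint_inverse hSig hSig')
  have hQS := hSig'.isInvertible.inverse_apply_self
  have hSQ := hSig'.isInvertible.self_apply_inverse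
  simp only at h1 h2 ⊢
  obtain ⟨e, he⟩ : ∃ e, e = x (n + 1) - a := ⟨_, rfl⟩
  obtain ⟨D, hD⟩ : ∃ D, D = x (n + 1) - x n := ⟨_, rfl⟩
  obtain ⟨f, hf⟩ : ∃ f, f = v n - b := ⟨_, rfl⟩
  obtain ⟨d, hd⟩ : ∃ d, d = v n - u n := ⟨_, rfl⟩
  have e1 : x n - a = e - D := by rw [he, hD]; abel
  have e2 : u n - b = f - d := by rw [hf, hd]; abel
  have e3 : u (n + 1) - b = Sig (L D) + f := by rw [hu, hf, hD]; abel
  have e4 : -Ups.inverse (x (n + 1) - x n) - L.adjoint (v n) - -L.adjoint b =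
      -Ups.inverse D - L.adjoint f := by rw [hf, hD, map_sub L.adjoint]; abel
  have e5 : L (x n) - Sig.inverse (v n - u n) - L a = L (e - D) - Sig.inverse d := by
    rw [← e1, hd, map_sub L]; abel
  rw [e4, ← he] at h1
  rw [e5, ← hf] at h2
  rw [e1, e2, e3, ← he, ← hD, ← hd]
  have hS : ⟪Sig (L D), Sig.inverse f⟫_ℝ = ⟪f, L D⟫_ℝ := by rw [hQ, hQS]
  simp only [metricSq, inner_add_left, inner_add_right, inner_sub_left, inner_sub_right,
    inner_neg_right, map_add, map_sub, hQS, hS, sub_apply,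
    ContinuousLinearMap.comp_apply, ContinuousLinearMap.adjoint_inner_right, hP D e, hQ d f,
    real_inner_comm f, real_inner_comm (L D) (Sig (L D))] at h1 h2 ⊢
  linarith

/-- Monotonicity of `A` between consecutive iterates. When `Ups⁻¹ - L* Sig L` is merely
monotone, the Fejér inequality alone does not control `x (n+1) - x n`; this inequality does. -/
theorem inner_step_le (hA : MonotoneOp A) {x : ℕ → E} {u v : ℕ → F}
    (h : IsInclusionSequence A B L Ups Sig x u v) (n : ℕ) :
    ⟪x (n + 2) - x (n + 1), Ups.inverse (x (n + 2) - x (n + 1))⟫_ℝ ≤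
      ⟪x (n + 2) - x (n + 1), (Ups.inverse - L.adjoint ∘L Sig ∘L L) (x (n + 1) - x n)⟫_ℝ -
        ⟪L (x (n + 2) - x (n + 1)), v (n + 1) - u (n + 1)⟫_ℝ := by
  have h1 := hA _ _ _ (h (n + 1)).2.1 _ (h n).2.1
  have hu := (h n).2.2
  have hv : v n = u (n + 1) - Sig (L (x (n + 1) - x n)) := by rw [hu]; abel
  rw [hv, show n + 1 + 1 = n + 2 from rfl] at h1
  generalize x (n + 2) - x (n + 1) = D at h1 ⊢
  generalize x (n + 1) - x n = D' at h1 ⊢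
  simp only [inner_sub_right, inner_neg_right, map_sub, sub_apply,
    ContinuousLinearMap.comp_apply, ContinuousLinearMap.adjoint_inner_right] at h1 ⊢
  linarith

/-- The operator `Ups⁻¹ - L* Sig L` is self-adjoint, so that, being monotone, it satisfies the
Cauchy–Schwarz inequality `inner_le_half_add`. -/
theorem isSelfAdjoint_schur (hUps : IsSelfAdjoint Ups) (hUps' : StronglyMonotone Ups)
    (hSig : IsSelfAdjoint Sig) :
    IsSelfAdjoint (Ups.inverse - L.adjoint ∘L Sig ∘L L) :=
  (isSelfAdjoint_inverse hUps hUps').sub (hSig.adjoint_conj L)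

theorem metricSq_inverse_nonneg (hUps' : StronglyMonotone Ups) (hSig' : StronglyMonotone Sig)
    (x : E) (u : F) : 0 ≤ metricSq Ups.inverse Sig.inverse x u := by
  obtain ⟨c, hc, hP⟩ := hUps'.inverse.exists_coercive
  obtain ⟨d, hd, hQ⟩ := hSig'.inverse.exists_coercive
  exact add_nonneg (le_trans (by positivity) (hP x)) (le_trans (by positivity) (hQ u))

theorem summable_steps (hA : MonotoneOp A) (hB : MonotoneOp B) (hUps : IsSelfAdjoint Ups)
    (hUps' : StronglyMonotone Ups) (hSig : IsSelfAdjoint Sig) (hSig' : StronglyMonotone Sig)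
    (hM : ∀ x, 0 ≤ ⟪x, (Ups.inverse - L.adjoint ∘L Sig ∘L L) x⟫_ℝ)
    {x : ℕ → E} {u v : ℕ → F} (h : IsInclusionSequence A B L Ups Sig x u v) {p : E × F}
    (hp : p ∈ kuhnTucker A B L) :
    Summable (fun n => ‖x (n + 1) - x n‖ ^ 2) ∧ Summable (fun n => ‖v n - u n‖ ^ 2) := by
  obtain ⟨c, hc, hP⟩ := hUps'.inverse.exists_coercive
  obtain ⟨d, hd, hQ⟩ := hSig'.inverse.exists_coercive
  have hQ0 : ∀ w, 0 ≤ ⟪w, Sig.inverse w⟫_ℝ := fun w => le_trans (by positivity) (hQ w)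
  have hsum := summable_of_add_le
    (D := fun n => metricSq Ups.inverse Sig.inverse (x n - p.1) (u n - p.2))
    (fun n => metricSq_inverse_nonneg hUps' hSig' _ _)
    (fun n => add_nonneg (hM (x (n + 1) - x n)) (hQ0 (v n - u n)))
    (fejer_step hA hB hUps hUps' hSig hSig' h hp)
  have hs1 := hsum.of_nonneg_of_le (fun n => hM (x (n + 1) - x n))
    fun n => le_add_of_nonneg_right (hQ0 _)
  have hs2 : Summable (fun n => ‖v n - u n‖ ^ 2) := by
    refine (hsum.mul_left d⁻¹).of_nonneg_of_le (fun n => by positivity) fun n => ?_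
    rw [le_inv_mul_iff₀ hd]
    linarith [hQ (v n - u n), hM (x (n + 1) - x n)]
  refine ⟨?_, hs2⟩
  rw [← summable_nat_add_iff 1]
  have hs2' := (summable_nat_add_iff 1).2 hs2
  refine ((((summable_nat_add_iff 1).2 hs1).add hs1).div_const c).add
    (hs2'.mul_left (‖L‖ ^ 2 / c ^ 2)) |>.of_nonneg_of_le (fun n => by positivity) fun n => ?_
  have h1 := inner_step_le hA h n
  have h2 := inner_le_half_add (inner_map_comm (isSelfAdjoint_schur hUps hUps' hSig)) hM
    (x (n + 2) - x (n + 1)) (x (n + 1) - x n)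
  have h3 := hP (x (n + 2) - x (n + 1))
  simp only [show ∀ k, k + 1 + 1 = k + 2 from fun _ => rfl]
  generalize x (n + 2) - x (n + 1) = D at *
  generalize x (n + 1) - x n = D' at *
  generalize v (n + 1) - u (n + 1) = w at *
  have h4 : -⟪L D, w⟫_ℝ ≤ ‖L‖ * ‖D‖ * ‖w‖ := by
    refine (neg_le_abs _).trans ((abs_real_inner_le_norm _ _).trans ?_)
    gcongr
    exact L.le_opNorm D
  -- Young's inequality with the weight that absorbs half of `c * ‖D‖ ^ 2`.
  have h5 : ‖L‖ * ‖D‖ * ‖w‖ ≤ c / 2 * ‖D‖ ^ 2 + ‖L‖ ^ 2 / (2 * c) * ‖w‖ ^ 2 := by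
    have : 0 ≤ (c * ‖D‖ - ‖L‖ * ‖w‖) ^ 2 / (2 * c) := by positivity
    have e : (c * ‖D‖ - ‖L‖ * ‖w‖) ^ 2 / (2 * c) =
        c / 2 * ‖D‖ ^ 2 + ‖L‖ ^ 2 / (2 * c) * ‖w‖ ^ 2 - ‖L‖ * ‖D‖ * ‖w‖ := by
      field_simp
      ring
    linarith
  refine le_of_mul_le_mul_left ?_ (half_pos hc)
  generalize ⟪D, (Ups.inverse - L.adjoint ∘L Sig ∘L L) D⟫_ℝ = r at *
  generalize ⟪D', (Ups.inverse - L.adjoint ∘L Sig ∘L L) D'⟫_ℝ = r' at *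
  have e : c / 2 * ((r + r') / c + ‖L‖ ^ 2 / c ^ 2 * ‖w‖ ^ 2) =
      (r + r') / 2 + ‖L‖ ^ 2 / (2 * c) * ‖w‖ ^ 2 := by
    field_simp
  rw [e]
  linarith

/-! ### Weak convergence -/

/-- The sum of `A × B⁻¹` and the skew operator `(x, u) ↦ (L* u, -L x)` is maximally monotone, so
a point monotonically related to its graph is a zero. -/
theorem mem_kuhnTucker_of_forall (hA : MaximallyMonotone A) (hB : MaximallyMonotone B)
    {a : E} {b : F} (h : ∀ y, ∀ r ∈ A y, ∀ z, ∀ s ∈ B z,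
      0 ≤ ⟪a - y, -L.adjoint b - r⟫_ℝ + ⟪L a - z, b - s⟫_ℝ) :
    (a, b) ∈ kuhnTucker A B L := by
  rw [mem_kuhnTucker_iff]
  by_cases hα : ∀ y, ∀ r ∈ A y, 0 ≤ ⟪a - y, -L.adjoint b - r⟫_ℝ
  · have ha : -L.adjoint b ∈ A a := hA.mem_of_forall hα
    refine ⟨ha, hB.mem_of_forall fun z s hs => ?_⟩
    simpa using h a _ ha z s hs
  · push Not at hα
    obtain ⟨y, r, hr, hneg⟩ := hα
    have hb : b ∈ B (L a) := hB.mem_of_forall fun z s hs => by linarith [h y r hr z s hs]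
    have := h y r hr _ b hb
    simp only [sub_self, inner_zero_left, add_zero] at this
    exact absurd this (not_le.2 hneg)

/-- Weak limits of the iterates are Kuhn–Tucker points. The products `⟪L (x n), u n⟫` of weakly
convergent sequences cancel between the two monotonicity inequalities. -/
theorem weak_limit_mem_kuhnTucker (hA : MaximallyMonotone A) (hB : MaximallyMonotone B)
    {x : ℕ → E} {u v : ℕ → F} (h : IsInclusionSequence A B L Ups Sig x u v)
    {l : Filter ℕ} [l.NeBot] {C C' : ℝ} (hxC : ∀ n, ‖x n‖ ≤ C) (huC : ∀ n, ‖u n‖ ≤ C')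
    (hD : Tendsto (fun n => x (n + 1) - x n) l (𝓝 0)) (hd : Tendsto (fun n => v n - u n) l (𝓝 0))
    {a : E} {b : F} (ha : ∀ y, Tendsto (fun n => ⟪x n, y⟫_ℝ) l (𝓝 ⟪a, y⟫_ℝ))
    (hb : ∀ y, Tendsto (fun n => ⟪u n, y⟫_ℝ) l (𝓝 ⟪b, y⟫_ℝ)) :
    (a, b) ∈ kuhnTucker A B L := by
  refine mem_kuhnTucker_of_forall hA hB fun y r hr z s hs => ?_
  set P := Ups.inverse with hPdef
  set Q := Sig.inverse with hQdef
  -- The part of the inequality that is affine in `(x n, u n)`.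
  have hmain : Tendsto (fun n => ⟪u n, L y⟫_ℝ - ⟪x n, r⟫_ℝ - ⟪x n, L.adjoint s⟫_ℝ - ⟪u n, z⟫_ℝ +
      (⟪y, r⟫_ℝ + ⟪z, s⟫_ℝ)) l (𝓝 (⟪b, L y⟫_ℝ - ⟪a, r⟫_ℝ - ⟪a, L.adjoint s⟫_ℝ - ⟪b, z⟫_ℝ +
      (⟪y, r⟫_ℝ + ⟪z, s⟫_ℝ))) :=
    ((((hb _).sub (ha _)).sub (ha _)).sub (hb _)).add_const _
  have hpair := hD.prodMk_nhds hd
  have hx0 : Tendsto (fun n => ⟪x n, P (x (n + 1) - x n)⟫_ℝ) l (𝓝 0) :=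
    tendsto_inner_zero_of_bounded hxC (by
      simpa only [map_zero, Function.comp_def] using (P.continuous.tendsto 0).comp hD)
  have hu0 : Tendsto (fun n => ⟪u n, L (x (n + 1) - x n) + Q (v n - u n)⟫_ℝ) l (𝓝 0) :=
    tendsto_inner_zero_of_bounded huC (by
      simpa only [map_zero, add_zero, Function.comp_def] using
        ((L.continuous.tendsto 0).comp hD).add ((Q.continuous.tendsto 0).comp hd))
  let R : E × F → ℝ := fun q => ⟪y, P q.1 + L.adjoint q.2⟫_ℝ -
    ⟪q.1, P q.1 + L.adjoint q.2 + r⟫_ℝ - ⟪z, q.2⟫_ℝ - ⟪Q q.2, q.2 - s⟫_ℝ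
  have hR : Tendsto (fun n => R (x (n + 1) - x n, v n - u n)) l (𝓝 0) := by
    have hc : Continuous R := by
      have := L.adjoint.continuous
      simp only [R]
      fun_prop
    simpa [R, Function.comp_def] using (hc.tendsto (0, 0)).comp hpair
  have hlim := ((hmain.sub hx0).sub hu0).add hR
  refine (ge_of_tendsto hlim (.of_forall fun n => ?_)).trans_eq ?_
  rotate_left
  · simp only [inner_sub_left, inner_sub_right, inner_neg_right,
      ContinuousLinearMap.adjoint_inner_right, map_sub, real_inner_comm b (L a),
      real_inner_comm b (L y), real_inner_comm b z]
    ring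
  · have h1 := hA.1 _ _ _ (h n).2.1 _ hr
    have h2 := hB.1 _ _ _ (h n).1 _ hs
    rw [← hPdef] at h1
    rw [← hQdef] at h2
    obtain ⟨D, hDn⟩ : ∃ D, D = x (n + 1) - x n := ⟨_, rfl⟩
    obtain ⟨d, hdn⟩ : ∃ d, d = v n - u n := ⟨_, rfl⟩
    have e1 : x (n + 1) = x n + D := by rw [hDn]; abel
    have e2 : v n = u n + d := by rw [hdn]; abel
    rw [← hDn, e1, e2] at h1
    rw [← hdn, e2] at h2
    rw [← hDn, ← hdn]
    simp only [R, inner_add_left, inner_add_right, inner_sub_left, inner_sub_right,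
      inner_neg_right, map_add, map_sub, ContinuousLinearMap.adjoint_inner_right,
      real_inner_comm (u n) (L D), real_inner_comm (u n) (L y),
      real_inner_comm (u n) (L (x n)), real_inner_comm (u n) z,
      real_inner_comm (u n) (Q d)] at h1 h2 ⊢
    linarith

/-- Opial's lemma along filters: in the Fejér metric, the distances to two Kuhn–Tucker points
that are weak limits converge, which forces these points to coincide. -/
theorem eq_of_weak_limits (hUps : IsSelfAdjoint Ups) (hUps' : StronglyMonotone Ups)
    (hSig : IsSelfAdjoint Sig) (hSig' : StronglyMonotone Sig) {x : ℕ → E} {u : ℕ → F}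
    {a a' : E} {b b' : F} {m m' : ℝ}
    (hm : Tendsto (fun n => metricSq Ups.inverse Sig.inverse (x n - a) (u n - b)) atTop (𝓝 m))
    (hm' : Tendsto (fun n => metricSq Ups.inverse Sig.inverse (x n - a') (u n - b')) atTop
      (𝓝 m'))
    {l l' : Filter ℕ} [l.NeBot] [l'.NeBot] (hl : l ≤ atTop) (hl' : l' ≤ atTop)
    (ha : ∀ y, Tendsto (fun n => ⟪x n, y⟫_ℝ) l (𝓝 ⟪a, y⟫_ℝ))
    (hb : ∀ y, Tendsto (fun n => ⟪u n, y⟫_ℝ) l (𝓝 ⟪b, y⟫_ℝ))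
    (ha' : ∀ y, Tendsto (fun n => ⟪x n, y⟫_ℝ) l' (𝓝 ⟪a', y⟫_ℝ))
    (hb' : ∀ y, Tendsto (fun n => ⟪u n, y⟫_ℝ) l' (𝓝 ⟪b', y⟫_ℝ)) : a = a' ∧ b = b' := by
  obtain ⟨c, hc, hPc⟩ := hUps'.inverse.exists_coercive
  obtain ⟨d, hd, hQd⟩ := hSig'.inverse.exists_coercive
  have hP := inner_map_comm (isSelfAdjoint_inverse hUps hUps')
  have hQ := inner_map_comm (isSelfAdjoint_inverse hSig hSig')
  set P := Ups.inverse
  set Q := Sig.inverse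
  have hdiff : Tendsto (fun n => ⟪x n, P (a - a')⟫_ℝ + ⟪u n, Q (b - b')⟫_ℝ) atTop
      (𝓝 ((metricSq P Q a b - metricSq P Q a' b' - (m - m')) / 2)) := by
    refine ((hm.sub hm').const_sub (metricSq P Q a b - metricSq P Q a' b')).div_const 2
      |>.congr fun n => ?_
    simp only [metricSq, map_sub, inner_sub_left, inner_sub_right, hP a (x n), hP a' (x n),
      hQ b (u n), hQ b' (u n)]
    ring
  have h1 := tendsto_nhds_unique (hdiff.mono_left hl)
    ((ha (P (a - a'))).add (hb (Q (b - b'))))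
  have h2 := tendsto_nhds_unique (hdiff.mono_left hl')
    ((ha' (P (a - a'))).add (hb' (Q (b - b'))))
  have h3 : ⟪a - a', P (a - a')⟫_ℝ + ⟪b - b', Q (b - b')⟫_ℝ = 0 := by
    rw [inner_sub_left, inner_sub_left]
    linarith
  have h4 := hPc (a - a')
  have h5 := hQd (b - b')
  constructor
  · by_contra hne
    have := norm_pos_iff.2 (sub_ne_zero.2 hne)
    have h6 : 0 < c * ‖a - a'‖ ^ 2 := by positivity
    have h7 : 0 ≤ d * ‖b - b'‖ ^ 2 := by positivity
    linarith
  · by_contra hne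
    have := norm_pos_iff.2 (sub_ne_zero.2 hne)
    have h6 : 0 < d * ‖b - b'‖ ^ 2 := by positivity
    have h7 : 0 ≤ c * ‖a - a'‖ ^ 2 := by positivity
    linarith

theorem exists_weak_limit_mem_kuhnTucker (hA : MaximallyMonotone A) (hB : MaximallyMonotone B)
    (hUps : IsSelfAdjoint Ups) (hUps' : StronglyMonotone Ups)
    (hSig : IsSelfAdjoint Sig) (hSig' : StronglyMonotone Sig)
    (hM : ∀ x, 0 ≤ ⟪x, (Ups.inverse - L.adjoint ∘L Sig ∘L L) x⟫_ℝ)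
    {x : ℕ → E} {u v : ℕ → F} (h : IsInclusionSequence A B L Ups Sig x u v)
    (hZ : (kuhnTucker A B L).Nonempty)
    (hD : Tendsto (fun n => x (n + 1) - x n) atTop (𝓝 0))
    (hd : Tendsto (fun n => v n - u n) atTop (𝓝 0)) :
    ∃ p ∈ kuhnTucker A B L, WeaklyConverges (fun n => (x n, u n)) p := by
  obtain ⟨c, hc, hPc⟩ := hUps'.inverse.exists_coercive
  obtain ⟨d, hd', hQd⟩ := hSig'.inverse.exists_coercive
  have hP0 : ∀ w, 0 ≤ ⟪w, Ups.inverse w⟫_ℝ := fun w => le_trans (by positivity) (hPc w)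
  have hQ0 : ∀ w, 0 ≤ ⟪w, Sig.inverse w⟫_ℝ := fun w => le_trans (by positivity) (hQd w)
  have hanti : ∀ p ∈ kuhnTucker A B L, Antitone fun n =>
      metricSq Ups.inverse Sig.inverse (x n - p.1) (u n - p.2) := fun p hp =>
    antitone_nat_of_succ_le fun n =>
      (le_add_of_nonneg_right (add_nonneg (hM _) (hQ0 _))).trans
        (fejer_step hA.1 hB.1 hUps hUps' hSig hSig' h hp n)
  have hconv : ∀ p ∈ kuhnTucker A B L, ∃ m, Tendsto (fun n =>
      metricSq Ups.inverse Sig.inverse (x n - p.1) (u n - p.2)) atTop (𝓝 m) := fun p hp =>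
    ⟨_, tendsto_atTop_ciInf (hanti p hp)
      ⟨0, by rintro _ ⟨n, rfl⟩; exact metricSq_inverse_nonneg hUps' hSig' _ _⟩⟩
  obtain ⟨q, hq⟩ := hZ
  obtain ⟨C, hC⟩ := exists_norm_le_of_inner_le hUps'.inverse q.1 fun n =>
    (le_add_of_nonneg_right (hQ0 (u n - q.2))).trans (hanti q hq (Nat.zero_le n))
  obtain ⟨C', hC'⟩ := exists_norm_le_of_inner_le hSig'.inverse q.2 fun n =>
    (le_add_of_nonneg_left (hP0 (x n - q.1))).trans (hanti q hq (Nat.zero_le n))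
  have hlim : ∀ U : Ultrafilter ℕ, (U : Filter ℕ) ≤ atTop → ∃ a b, (a, b) ∈ kuhnTucker A B L ∧
      (∀ y, Tendsto (fun n => ⟪x n, y⟫_ℝ) U (𝓝 ⟪a, y⟫_ℝ)) ∧
      ∀ y, Tendsto (fun n => ⟪u n, y⟫_ℝ) U (𝓝 ⟪b, y⟫_ℝ) := by
    intro U hU
    obtain ⟨a, ha⟩ := exists_weak_limit U hC
    obtain ⟨b, hb⟩ := exists_weak_limit U hC'
    exact ⟨a, b, weak_limit_mem_kuhnTucker hA hB h hC hC' (hD.mono_left hU) (hd.mono_left hU)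
      ha hb, ha, hb⟩
  obtain ⟨a, b, hab, ha, hb⟩ := hlim _ (Ultrafilter.of_le atTop)
  obtain ⟨m, hm⟩ := hconv _ hab
  have hall : ∀ U : Ultrafilter ℕ, (U : Filter ℕ) ≤ atTop →
      (∀ y, Tendsto (fun n => ⟪x n, y⟫_ℝ) U (𝓝 ⟪a, y⟫_ℝ)) ∧
      ∀ y, Tendsto (fun n => ⟪u n, y⟫_ℝ) U (𝓝 ⟪b, y⟫_ℝ) := by
    intro U hU
    obtain ⟨a', b', hab', ha', hb'⟩ := hlim U hU
    obtain ⟨m', hm'⟩ := hconv _ hab'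
    obtain ⟨rfl, rfl⟩ := eq_of_weak_limits hUps hUps' hSig hSig' hm hm'
      (Ultrafilter.of_le atTop) hU ha hb ha' hb'
    exact ⟨ha', hb'⟩
  exact ⟨(a, b), hab, weaklyConverges_of_tendsto_inner
    (fun y => (tendsto_iff_ultrafilter _ _ _).2 fun U hU => (hall U hU).1 y)
    (fun y => (tendsto_iff_ultrafilter _ _ _).2 fun U hU => (hall U hU).2 y)⟩

end Recurrence

end SplitDR

theorem mainTheorem1 {H G : Type*}
    [NormedAddCommGroup H] [InnerProductSpace ℝ H] [CompleteSpace H]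
    [NormedAddCommGroup G] [InnerProductSpace ℝ G] [CompleteSpace G]
    (A : H → Set H) (B : G → Set G) (L : H →L[ℝ] G)
    (hA : SplitDR.MaximallyMonotone A) (hB : SplitDR.MaximallyMonotone B) (hL : L ≠ 0)
    (hZ : (SplitDR.kuhnTucker A B L).Nonempty)
    (Ups : H →L[ℝ] H) (Sig : G →L[ℝ] G)
    (hUps : IsSelfAdjoint Ups) (hUps' : SplitDR.StronglyMonotone Ups)
    (hSig : IsSelfAdjoint Sig) (hSig' : SplitDR.StronglyMonotone Sig)
    (hU : SplitDR.MonotoneOp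
      (fun x => {(Ups.inverse - L.adjoint ∘L Sig ∘L L : H →L[ℝ] H) x}))
    (x₀ : H) (u₀ : G) :
    (∃! w : (ℕ → H) × (ℕ → G), SplitDR.IsSDRSequence A B L Ups Sig x₀ u₀ w.1 w.2) ∧
    ∀ (x : ℕ → H) (u : ℕ → G), SplitDR.IsSDRSequence A B L Ups Sig x₀ u₀ x u →
      (Summable (fun n => ‖x (n + 1) - x n‖ ^ 2) ∧
        Summable (fun n => ‖u (n + 1) - u n‖ ^ 2)) ∧
      ∃ xu ∈ SplitDR.kuhnTucker A B L, SplitDR.WeaklyConverges (fun n => (x n, u n)) xu := by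
  refine ⟨SplitDR.existsUnique_isSDRSequence hA hB hUps hUps' hSig hSig' x₀ u₀, fun x u hxu => ?_⟩
  obtain ⟨v, h⟩ := hxu.exists_isInclusionSequence hUps' hSig'
  have hM : ∀ x, 0 ≤ ⟪x, (Ups.inverse - L.adjoint ∘L Sig ∘L L) x⟫_ℝ := fun x => by
    simpa only [map_zero, sub_zero] using hU x 0 _ rfl _ rfl
  obtain ⟨p, hp⟩ := hZ
  obtain ⟨hsx, hsv⟩ := SplitDR.summable_steps hA.1 hB.1 hUps hUps' hSig hSig' hM h hp
  refine ⟨⟨hsx, ?_⟩, SplitDR.exists_weak_limit_mem_kuhnTucker hA hB hUps hUps' hSig hSig' hM h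
    ⟨p, hp⟩ (SplitDR.tendsto_zero_of_summable_sq hsx) (SplitDR.tendsto_zero_of_summable_sq hsv)⟩
  refine SplitDR.summable_sq_of_le (c := ‖Sig ∘L L‖) hsx hsv (fun n => norm_nonneg _) fun n => ?_
  rw [(h n).2.2, add_sub_assoc]
  exact (norm_add_le _ _).trans (add_le_add_left ((Sig ∘L L).le_opNorm _) _)
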